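/- **Theorem 1.** Consider finite undirected graphs $G=(V,D,L)$ with a symmetric edge set $D\subseteq V^2$ and node labels $L:V\to\mathbb{R}^n$, $n \in \mathbb{N}$. A neural network (NN) is a feed-forward network with rational weights and biases and with ReLU activation in every layer. A graph-classifier MPNN $N$ with input dimension $n$ consists of layers $l_1,\dots,l_k$, $k\ge 1$, and a readout. It computes $x_v^0=L(v)$, $x_v^i=N_i\bigl(x_v^{i-1},\sum_{(v,w)\in D}x_w^{i-1}\bigr)$ for all $v\in V$ and $1\le i\le k$, and the output $N(G)=N_r\bigl(\sum_{v\in V}x_v^k\bigr)$, where $N_1,\dots,N_k,N_r$ are NNs. Let $\Phi$ be any set of finitely described graph specifications (each $\varphi \in \Phi$ defines a set of graphs; write $G\models\varphi$ for membership) that contains at least one specification allowing graphs of arbitrary size, degree up to $4$ and natural-number labels, i.e. a $\varphi$ satisfied by every finite graph, with labels of any dimension, in which each node has at most $4$ neighbours and all label entries are natural numbers; for instance $\varphi=\mathsf{true}$. Let $\Psi_{\mathsf{eq}}$ be the set of output specifications $x_i=b$ with $b\in\mathbb{Q}$, where $y \models (x_i = b)$ means that the $i$-th entry of $y$ equals $b$.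 Then $\mathrm{ORP}_{\mathsf{graph}}(\Phi,\Psi_{\mathsf{eq}})$ is not formally verifiable: there is no algorithm that, given a graph-classifier MPNN $N$, a specification $\varphi\in\Phi$ and a specification $\psi\in\Psi_{\mathsf{eq}}$ on the output of $N$, always terminates and decides correctly whether there is a graph $G$ with $G\models\varphi$ and $N(G)\models\psi$. -/

import Mathlib

universe u

/-! ### Labelled graphs -/

/-- A finite graph whose nodes are labelled by vectors in `ℝⁿ`. The edge set is any symmetric
subset of `V × V`. -/
structure LGraph (n : ℕ) where
  V : Type
  [fin : Fintype V]
  Adj : V → V → Prop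
  symm : ∀ v w, Adj v w → Adj w v
  label : V → Fin n → ℝ

attribute [instance] LGraph.fin

namespace LGraph

open Classical in
/-- The neighbourhood of a node. -/
noncomputable def neigh {n : ℕ} (G : LGraph n) (v : G.V) : Finset G.V :=
  Finset.univ.filter (fun w => G.Adj v w)

/-- The degree of the graph is at most `d`. -/
def DegreeLE {n : ℕ} (G : LGraph n) (d : ℕ) : Prop :=
  ∀ v : G.V, (G.neigh v).card ≤ d

/-- All entries of all labels are natural numbers. -/
def NatLabelled {n : ℕ} (G : LGraph n) : Prop :=
  ∀ (v : G.V) (i : Fin n), ∃ k : ℕ, G.label v i = k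

end LGraph

/-! ### ReLU networks with rational parameters -/

/-- A fully connected layer from `ℝᵐ` to `ℝⁿ` with rational weights and biases. -/
structure ReLULayer (m n : ℕ) where
  weight : Matrix (Fin n) (Fin m) ℚ
  bias : Fin n → ℚ

/-- The function computed by a layer, `x ↦ max(0, W x + b)`. -/
noncomputable def ReLULayer.eval {m n : ℕ} (l : ReLULayer m n) (x : Fin m → ℝ) : Fin n → ℝ :=
  fun i => max 0 ((∑ j, (l.weight i j : ℝ) * x j) + (l.bias i : ℝ))

/-- A feed-forward neural network from `ℝᵐ` to `ℝⁿ`: a non-empty sequence of ReLU layers. -/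
inductive NN : ℕ → ℕ → Type
  | last {m n : ℕ} (l : ReLULayer m n) : NN m n
  | cons {m k n : ℕ} (l : ReLULayer m k) (N : NN k n) : NN m n

/-- The function computed by a neural network. -/
noncomputable def NN.eval : {m n : ℕ} → NN m n → (Fin m → ℝ) → (Fin n → ℝ)
  | _, _, .last l, x => l.eval x
  | _, _, .cons l N, x => N.eval (l.eval x)

/-! ### Graph-classifier message passing neural networks -/

/-- One message passing layer: sum aggregation over the neighbourhood, followed by a
combination network applied to the pair (own vector, aggregated vector). -/
noncomputable def mpStep {n p q : ℕ} (G : LGraph n) (comb : NN (p + p) q)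
    (x : G.V → Fin p → ℝ) : G.V → Fin q → ℝ :=
  fun v => comb.eval (Fin.append (x v) (∑ w ∈ G.neigh v, x w))

/-- A non-empty sequence of message passing layers, each given by its combination network. -/
inductive MPLayers : ℕ → ℕ → Type
  | last {m n : ℕ} (comb : NN (m + m) n) : MPLayers m n
  | cons {m k n : ℕ} (comb : NN (m + m) k) (Ls : MPLayers k n) : MPLayers m n

/-- The vectors of all nodes after the application of all message passing layers. -/
noncomputable def MPLayers.run {d : ℕ} (G : LGraph d) :
    {m n : ℕ} → MPLayers m n → (G.V → Fin m → ℝ) → (G.V → Fin n → ℝ)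
  | _, _, .last c, x => mpStep G c x
  | _, _, .cons c Ls, x => Ls.run G (mpStep G c x)

/-- A graph-classifier MPNN for graphs with labels in `ℝⁿ` and with outputs in `ℝᵒ`. -/
structure GraphMPNN (n o : ℕ) where
  hid : ℕ
  layers : MPLayers n hid
  read : NN hid o

/-- The output `N(G)`: the readout network is applied to the sum of all node vectors. -/
noncomputable def GraphMPNN.eval {n o : ℕ} (N : GraphMPNN n o) (G : LGraph n) : Fin o → ℝ :=
  N.read.eval (∑ v : G.V, N.layers.run G G.label v)

/-! ### Finite descriptions of MPNNs, the inputs of algorithms -/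

/-- Sign, absolute value of the numerator, and denominator of a rational number. -/
abbrev RatCode : Type := Bool × ℕ × ℕ

def ratCode (q : ℚ) : RatCode := (decide (q < 0), q.num.natAbs, q.den)

/-- The rows of the weight matrix, each together with its bias. -/
abbrev LayerCode : Type := List (List RatCode × RatCode)

def ReLULayer.code {m n : ℕ} (l : ReLULayer m n) : LayerCode :=
  List.ofFn fun i => (List.ofFn fun j => ratCode (l.weight i j), ratCode (l.bias i))

def NN.layerCodes : {m n : ℕ} → NN m n → List LayerCode
  | _, _, .last l => [l.code]
  | _, _, .cons l N => l.code :: N.layerCodes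

/-- The input dimension and the list of layers. -/
abbrev NNCode : Type := ℕ × List LayerCode

def NN.code {m n : ℕ} (N : NN m n) : NNCode := (m, N.layerCodes)

def MPLayers.code : {m n : ℕ} → MPLayers m n → List NNCode
  | _, _, .last c => [c.code]
  | _, _, .cons c Ls => c.code :: Ls.code

/-- The combination networks and the readout network. -/
abbrev MPNNCode : Type := List NNCode × NNCode

def GraphMPNN.code {n o : ℕ} (N : GraphMPNN n o) : MPNNCode := (N.layers.code, N.read.code)

/-! ### Specifications and output reachability properties -/

/-- Output specifications on `ℝᵒ` of the form `x_i = b` with rational `b`. -/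
structure EqSpec (o : ℕ) where
  idx : Fin o
  val : ℚ

/-- The vector `y` satisfies the specification `x_i = b`. -/
def EqSpec.Sat {o : ℕ} (ψ : EqSpec o) (y : Fin o → ℝ) : Prop := y ψ.idx = (ψ.val : ℝ)

def EqSpec.code {o : ℕ} (ψ : EqSpec o) : ℕ × RatCode := (ψ.idx, ratCode ψ.val)

/-- The language `Φ` of graph specifications, with satisfaction relation `sat`, contains a
specification that allows all graphs (of any size, and with labels of any dimension) of degree
at most `4` whose labels have natural number entries. -/
def ContainsUnbounded {Φ : Type u} (sat : Φ → ∀ n : ℕ, LGraph n → Prop) : Prop :=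
  ∃ φ : Φ, ∀ (n : ℕ) (G : LGraph n), G.DegreeLE 4 → G.NatLabelled → sat φ n G

/-- An output reachability property `(N, φ, ψ)` of a graph-classifier MPNN `N` with input
specification `φ` from `Φ` and output specification `ψ` of the form `x_i = b`. -/
structure ORPGraph (Φ : Type u) where
  inDim : ℕ
  outDim : ℕ
  net : GraphMPNN inDim outDim
  inSpec : Φ
  outSpec : EqSpec outDim

/-- The property holds: some graph satisfying `φ` is mapped to a vector satisfying `ψ`. -/
def ORPGraph.Holds {Φ : Type u} (sat : Φ → ∀ n : ℕ, LGraph n → Prop) (Q : ORPGraph Φ) : Prop :=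
  ∃ G : LGraph Q.inDim, sat Q.inSpec Q.inDim G ∧ Q.outSpec.Sat (Q.net.eval G)

/-- The description of the property that is given to an algorithm. -/
def ORPGraph.code {Φ : Type u} (Q : ORPGraph Φ) : MPNNCode × Φ × (ℕ × RatCode) :=
  (Q.net.code, Q.inSpec, Q.outSpec.code)

/-- A class `P` of safety properties, described to algorithms through `code`, is formally
verifiable: there is an algorithm that, on the description of each property of the class,
terminates and answers `true` if and only if the property holds. Nothing is required on data
that describe no property of the class. -/
def FormallyVerifiable {P C : Type u} [Primcodable C] (code : P → C) (Holds : P → Prop) : Prop :=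
  ∃ A : C →. Bool, Partrec A ∧ ∀ p : P, ∃ b ∈ A (code p), (b = true ↔ Holds p)

/-! ### Piecewise linear functions and the networks computing them -/

/-! The halting problem on input 0 reduces to output reachability. Halting of a program is witnessed
by a finite derivation tree whose nodes are judgements, tuples of five natural numbers, each
following from at most three others by a `Clause`. Clauses are Boolean combinations of linear
equations and inequalities: the only product needed is the square inside `Nat.pair`, and squares are
themselves derived by (n+1)² = n² + 2n + 1. Hence ReLU networks test clauses exactly
(`isPLPred_clause`, `IsPL.exists_NN`).

A tree becomes an undirected graph of degree at most 4. Sum aggregation forgets which neighbour sent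
what, so records are kept in slots that separate the children of a node from each other and from its
parent. One layer computes at each node a non-negative violation of `LocallyValid`; the violations
sum to zero iff every node is valid. The readout also demands exactly one root, about the given
program.

Conversely, any graph that passes the test, even with real labels and cycles, proves halting: a
non-negative counter drops by at least 1 from a node to each child, so induction makes all
judgements true (`LGraph.sem_of_locallyValid`). Only two readout biases depend on the program, so a
verifier would decide halting. -/

theorem NN.eval_nonneg {m n : ℕ} (N : NN m n) (x : Fin m → ℝ) (i : Fin n) : 0 ≤ N.eval x i := by
  induction N with
  | last l => exact le_max_left _ _
  | cons l N ih => exact ih _ _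

/-- Composition of networks. -/
def NN.comp : {m k n : ℕ} → NN m k → NN k n → NN m n
  | _, _, _, .last l, M => .cons l M
  | _, _, _, .cons l N, M => .cons l (N.comp M)

theorem NN.eval_comp {m k n : ℕ} (N : NN m k) (M : NN k n) (x : Fin m → ℝ) :
    (N.comp M).eval x = M.eval (N.eval x) := by
  induction N with
  | last l => rfl
  | cons l N ih => exact ih _ _

/-- The functions that are rational affine combinations of the outputs of a network. -/
def NN.affineSpan {m n : ℕ} (N : NN m n) : Set ((Fin m → ℝ) → ℝ) :=
  {f | ∃ (w : Fin n → ℚ) (b : ℚ), ∀ x, f x = (∑ j, (w j : ℝ) * N.eval x j) + (b : ℝ)}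

theorem NN.eval_mem_affineSpan {m n : ℕ} (N : NN m n) (i : Fin n) :
    (fun x => N.eval x i) ∈ N.affineSpan :=
  ⟨fun j => if j = i then 1 else 0, 0, fun x => by simp [apply_ite (Rat.cast : ℚ → ℝ)]⟩

theorem NN.const_mem_affineSpan {m n : ℕ} (N : NN m n) (q : ℚ) :
    (fun _ => (q : ℝ)) ∈ N.affineSpan :=
  ⟨0, q, fun x => by simp⟩

theorem NN.add_mem_affineSpan {m n : ℕ} {N : NN m n} {f g : (Fin m → ℝ) → ℝ}
    (hf : f ∈ N.affineSpan) (hg : g ∈ N.affineSpan) : (fun x => f x + g x) ∈ N.affineSpan := by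
  obtain ⟨w, b, h⟩ := hf
  obtain ⟨w', b', h'⟩ := hg
  refine ⟨w + w', b + b', fun x => ?_⟩
  simp only [h, h', Pi.add_apply, Rat.cast_add, add_mul, Finset.sum_add_distrib]
  ring

theorem NN.const_mul_mem_affineSpan {m n : ℕ} {N : NN m n} {f : (Fin m → ℝ) → ℝ} (q : ℚ)
    (hf : f ∈ N.affineSpan) : (fun x => (q : ℝ) * f x) ∈ N.affineSpan := by
  obtain ⟨w, b, h⟩ := hf
  refine ⟨fun j => q * w j, q * b, fun x => ?_⟩
  simp only [h, Rat.cast_mul, mul_add, Finset.mul_sum, mul_assoc]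

theorem NN.sum_mem_affineSpan {m n : ℕ} {N : NN m n} {ι : Type*} (s : Finset ι)
    {f : ι → (Fin m → ℝ) → ℝ} (hf : ∀ i ∈ s, f i ∈ N.affineSpan) :
    (fun x => ∑ i ∈ s, f i x) ∈ N.affineSpan := by
  classical
  induction s using Finset.induction_on with
  | empty => simpa using N.const_mem_affineSpan 0
  | insert a s ha ih =>
    simp only [Finset.sum_insert ha]
    exact NN.add_mem_affineSpan (hf a (Finset.mem_insert_self a s))
      (ih fun i hi => hf i (Finset.mem_insert_of_mem hi))

theorem NN.affineSpan_le {m n n' : ℕ} {N : NN m n} {N' : NN m n'}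
    (h : ∀ i, (fun x => N.eval x i) ∈ N'.affineSpan) : N.affineSpan ⊆ N'.affineSpan := by
  rintro f ⟨w, b, hf⟩
  rw [show f = _ from funext hf]
  exact NN.add_mem_affineSpan
    (NN.sum_mem_affineSpan _ fun j _ => NN.const_mul_mem_affineSpan _ (h j))
    (NN.const_mem_affineSpan _ _)

/-- Affine combinations of the outputs of a network become outputs, up to a ReLU, after one more
layer. -/
theorem NN.exists_eval_eq_relu {m n k : ℕ} {N : NN m n} {f : Fin k → (Fin m → ℝ) → ℝ}
    (hf : ∀ i, f i ∈ N.affineSpan) : ∃ N' : NN m k, ∀ x i, N'.eval x i = max 0 (f i x) := by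
  choose w b h using hf
  refine ⟨N.comp (.last ⟨w, b⟩), fun x i => ?_⟩
  rw [NN.eval_comp, h]
  rfl

/-- Outputs of a network are non-negative, so one more ReLU layer can copy them unchanged while
adding the ReLU of `f` as a new output. -/
theorem NN.exists_relu_mem_affineSpan {m n : ℕ} (N : NN m n) {f : (Fin m → ℝ) → ℝ}
    (hf : f ∈ N.affineSpan) : ∃ (n' : ℕ) (N' : NN m n'),
      N.affineSpan ⊆ N'.affineSpan ∧ (fun x => max 0 (f x)) ∈ N'.affineSpan := by
  obtain ⟨N', h⟩ := NN.exists_eval_eq_relu (N := N)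
    (f := Fin.cons f fun i x => N.eval x i) (k := n + 1) (fun i => by
      refine Fin.cases ?_ (fun i => ?_) i
      · simpa using hf
      · simpa using N.eval_mem_affineSpan i)
  refine ⟨n + 1, N', NN.affineSpan_le fun i => ?_, ?_⟩
  · have := N'.eval_mem_affineSpan i.succ
    simpa [h, N.eval_nonneg] using this
  · have := N'.eval_mem_affineSpan 0
    simpa [h] using this

/-- Signed inputs survive the ReLU through x = max 0 x - max 0 (-x). -/
theorem NN.exists_coord_mem_affineSpan (m : ℕ) :
    ∃ (n : ℕ) (N : NN m n), ∀ j, (fun x : Fin m → ℝ => x j) ∈ N.affineSpan := by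
  let N : NN m (m + m) := .last ⟨Fin.append (fun i j => if j = i then 1 else 0)
    (fun i j => if j = i then -1 else 0), 0⟩
  refine ⟨m + m, N, fun j => ?_⟩
  have h := NN.add_mem_affineSpan (N.eval_mem_affineSpan (Fin.castAdd m j))
    (NN.const_mul_mem_affineSpan (-1) (N.eval_mem_affineSpan (Fin.natAdd m j)))
  convert h using 2 with x
  have h1 : N.eval x (Fin.castAdd m j) = max 0 (x j) := by
    simp [N, NN.eval, ReLULayer.eval, -Fin.natAdd_eq_addNat, apply_ite (Rat.cast : ℚ → ℝ)]
  have h2 : N.eval x (Fin.natAdd m j) = max 0 (- x j) := by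
    simp [N, NN.eval, ReLULayer.eval, -Fin.natAdd_eq_addNat, apply_ite (Rat.cast : ℚ → ℝ)]
  rw [h1, h2]
  push_cast
  rcases le_total 0 (x j) with h | h
  · rw [max_eq_right h, max_eq_left (by linarith)]; ring
  · rw [max_eq_left h, max_eq_right (by linarith)]; ring

/-- Continuous piecewise linear functions with rational coefficients. -/
inductive IsPL {m : ℕ} : ((Fin m → ℝ) → ℝ) → Prop
  | coord (j : Fin m) : IsPL fun x => x j
  | const (q : ℚ) : IsPL fun _ => (q : ℝ)
  | add {f g : (Fin m → ℝ) → ℝ} : IsPL f → IsPL g → IsPL fun x => f x + g x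
  | const_mul (q : ℚ) {f : (Fin m → ℝ) → ℝ} : IsPL f → IsPL fun x => (q : ℝ) * f x
  | relu {f : (Fin m → ℝ) → ℝ} : IsPL f → IsPL fun x => max 0 (f x)

namespace IsPL

variable {m : ℕ} {f g : (Fin m → ℝ) → ℝ}

/-- The starting network is arbitrary so that, for a sum, the network for the second summand can be
built on top of the one for the first without losing it. -/
theorem exists_mem_affineSpan (hf : IsPL f) :
    ∀ {n : ℕ} (N : NN m n), (∀ j, (fun x : Fin m → ℝ => x j) ∈ N.affineSpan) →
      ∃ (n' : ℕ) (N' : NN m n'), N.affineSpan ⊆ N'.affineSpan ∧ f ∈ N'.affineSpan := by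
  induction hf with
  | coord j => exact fun N hN => ⟨_, N, subset_rfl, hN j⟩
  | const q => exact fun N hN => ⟨_, N, subset_rfl, N.const_mem_affineSpan q⟩
  | add _ _ ihf ihg =>
    intro n N hN
    obtain ⟨n₁, N₁, h₁, hf⟩ := ihf N hN
    obtain ⟨n₂, N₂, h₂, hg⟩ := ihg N₁ fun j => h₁ (hN j)
    exact ⟨n₂, N₂, h₁.trans h₂, NN.add_mem_affineSpan (h₂ hf) hg⟩
  | const_mul q _ ihf =>
    intro n N hN
    obtain ⟨n₁, N₁, h₁, hf⟩ := ihf N hN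
    exact ⟨n₁, N₁, h₁, NN.const_mul_mem_affineSpan q hf⟩
  | relu _ ihf =>
    intro n N hN
    obtain ⟨n₁, N₁, h₁, hf⟩ := ihf N hN
    obtain ⟨n₂, N₂, h₂, hr⟩ := N₁.exists_relu_mem_affineSpan hf
    exact ⟨n₂, N₂, h₁.trans h₂, hr⟩

/-- Piecewise linear functions are, up to a final ReLU, computed by networks. -/
theorem exists_NN {k : ℕ} {f : Fin k → (Fin m → ℝ) → ℝ} (hf : ∀ i, IsPL (f i)) :
    ∃ N : NN m k, ∀ x i, N.eval x i = max 0 (f i x) := by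
  -- All components must lie in the span of one common network, which is grown one component at a
  -- time.
  have key : ∀ s : Finset (Fin k), ∃ (n : ℕ) (N : NN m n),
      (∀ j, (fun x : Fin m → ℝ => x j) ∈ N.affineSpan) ∧ ∀ i ∈ s, f i ∈ N.affineSpan := by
    intro s
    induction s using Finset.induction_on with
    | empty =>
      obtain ⟨n, N, hN⟩ := NN.exists_coord_mem_affineSpan m
      exact ⟨n, N, hN, by simp⟩
    | insert a s _ ih =>
      obtain ⟨n, N, hN, hs⟩ := ih
      obtain ⟨n', N', h, ha⟩ := (hf a).exists_mem_affineSpan N hN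
      refine ⟨n', N', fun j => h (hN j), fun i hi => ?_⟩
      rcases Finset.mem_insert.1 hi with rfl | hi
      · exact ha
      · exact h (hs i hi)
  obtain ⟨n, N, -, hN⟩ := key Finset.univ
  exact NN.exists_eval_eq_relu fun i => hN i (Finset.mem_univ i)

theorem zero : IsPL (m := m) fun _ => (0 : ℝ) := by simpa using IsPL.const (m := m) 0

theorem one : IsPL (m := m) fun _ => (1 : ℝ) := by simpa using IsPL.const (m := m) 1

theorem ofNat (k : ℕ) [k.AtLeastTwo] : IsPL (m := m) fun _ => (OfNat.ofNat k : ℝ) := by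
  simpa using IsPL.const (m := m) (OfNat.ofNat k)

theorem ofNat_mul (k : ℕ) [k.AtLeastTwo] (hf : IsPL f) :
    IsPL fun x => (OfNat.ofNat k : ℝ) * f x := by
  simpa using IsPL.const_mul (OfNat.ofNat k) hf

theorem sub (hf : IsPL f) (hg : IsPL g) : IsPL fun x => f x - g x := by
  simpa [sub_eq_add_neg] using hf.add (IsPL.const_mul (-1) hg)

theorem sum {ι : Type*} (s : Finset ι) {f : ι → (Fin m → ℝ) → ℝ} (hf : ∀ i, IsPL (f i)) :
    IsPL fun x => ∑ i ∈ s, f i x := by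
  classical
  induction s using Finset.induction_on with
  | empty => simpa using IsPL.zero
  | insert a s ha ih => simpa only [Finset.sum_insert ha] using (hf a).add ih

/-- min(f, g) = f - max(0, f - g). -/
theorem min (hf : IsPL f) (hg : IsPL g) : IsPL fun x => min (f x) (g x) := by
  have h := hf.sub (hf.sub hg).relu
  convert h using 2 with x
  rcases le_total (f x) (g x) with h | h
  · rw [min_eq_left h, max_eq_left (by linarith)]; ring
  · rw [min_eq_right h, max_eq_right (by linarith)]; ring

end IsPL

/-- Predicates that define the zero set of a non-negative piecewise linear function. -/
def IsPLPred {m : ℕ} (P : (Fin m → ℝ) → Prop) : Prop :=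
  ∃ f : (Fin m → ℝ) → ℝ, IsPL f ∧ (∀ x, 0 ≤ f x) ∧ ∀ x, f x = 0 ↔ P x

namespace IsPLPred

variable {m : ℕ} {P Q : (Fin m → ℝ) → Prop} {f g : (Fin m → ℝ) → ℝ}

/-- A sum of non-negative functions vanishes exactly where both do; for `or`, the minimum takes the
place of the sum. -/
theorem and (hP : IsPLPred P) (hQ : IsPLPred Q) : IsPLPred fun x => P x ∧ Q x := by
  obtain ⟨f, hf, f0, hfP⟩ := hP
  obtain ⟨g, hg, g0, hgQ⟩ := hQ
  refine ⟨_, hf.add hg, fun x => add_nonneg (f0 x) (g0 x), fun x => ?_⟩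
  rw [add_eq_zero_iff_of_nonneg (f0 x) (g0 x), hfP, hgQ]

theorem or (hP : IsPLPred P) (hQ : IsPLPred Q) : IsPLPred fun x => P x ∨ Q x := by
  obtain ⟨f, hf, f0, hfP⟩ := hP
  obtain ⟨g, hg, g0, hgQ⟩ := hQ
  refine ⟨_, hf.min hg, fun x => le_min (f0 x) (g0 x), fun x => ?_⟩
  dsimp only
  rw [← hfP, ← hgQ]
  constructor
  · intro h
    rcases min_choice (f x) (g x) with h' | h' <;> rw [h'] at h
    · exact Or.inl h
    · exact Or.inr h
  · rintro (h | h)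
    · rw [h]; exact min_eq_left (g0 x)
    · rw [h]; exact min_eq_right (f0 x)

theorem le (hf : IsPL f) (hg : IsPL g) : IsPLPred fun x => f x ≤ g x :=
  ⟨_, (hf.sub hg).relu, fun _ => le_max_left _ _, fun x => by
    rw [max_eq_left_iff, sub_nonpos]⟩

theorem eq (hf : IsPL f) (hg : IsPL g) : IsPLPred fun x => f x = g x := by
  simpa only [le_antisymm_iff] using (le hf hg).and (le hg hf)

theorem of_forall (h : ∀ x, P x) : IsPLPred P :=
  ⟨_, IsPL.zero, fun _ => le_rfl, fun x => by simp [h x]⟩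

theorem of_forall_not (h : ∀ x, ¬ P x) : IsPLPred P :=
  ⟨_, IsPL.one, fun _ => zero_le_one, fun x => by simp [h x]⟩

theorem imp {p : Prop} (hP : IsPLPred P) : IsPLPred fun x => p → P x := by
  by_cases h : p
  · simpa [h] using hP
  · exact of_forall fun x h' => absurd h' h

theorem all {ι : Type*} [Fintype ι] {P : ι → (Fin m → ℝ) → Prop} (hP : ∀ i, IsPLPred (P i)) :
    IsPLPred fun x => ∀ i, P i x := by
  have key : ∀ s : Finset ι, IsPLPred fun x => ∀ i ∈ s, P i x := by
    classical
    intro s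
    induction s using Finset.induction_on with
    | empty => exact of_forall (by simp)
    | insert a s _ ih => simpa only [Finset.forall_mem_insert] using (hP a).and ih
  simpa using key Finset.univ

theorem any {ι : Type*} [Fintype ι] {P : ι → (Fin m → ℝ) → Prop} (hP : ∀ i, IsPLPred (P i)) :
    IsPLPred fun x => ∃ i, P i x := by
  have key : ∀ s : Finset ι, IsPLPred fun x => ∃ i ∈ s, P i x := by
    classical
    intro s
    induction s using Finset.induction_on with
    | empty => exact of_forall_not (by simp)
    | insert a s _ ih => simpa only [Finset.exists_mem_insert] using (hP a).or ih
  simpa using key Finset.univ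

end IsPLPred

/-! ### A system of clauses for the evaluation of codes of partial recursive functions -/

section Clauses

variable (d : Fin 5 → ℝ) (c : Fin 3 → Fin 5 → ℝ)

/-- `n² = s`, with `d = (1, n, s)`. -/
def SqClause : Prop :=
  (d 1 = 0 ∧ d 2 = 0) ∨ (c 0 0 = 1 ∧ d 1 = c 0 1 + 1 ∧ d 2 = c 0 2 + 2 * c 0 1 + 1)

/-- `Nat.pair a b = x`, with `d = (2, a, b, x)`. -/
def PairClause : Prop :=
  c 0 0 = 1 ∧ c 0 1 = d 1 ∧ c 1 0 = 1 ∧ c 1 1 = d 2 ∧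
    ((d 1 + 1 ≤ d 2 ∧ d 3 = c 1 2 + d 1) ∨ (d 2 ≤ d 1 ∧ d 3 = c 0 2 + d 1 + d 2))

/-- The code `e` maps `x` to `y`, with `d = (3, e, x, y)`. -/
def EvalClause : Prop :=
  (d 1 = 0 ∧ d 3 = 0 ∧ c 0 0 = 1 ∧ c 0 1 = d 2) ∨
  (d 1 = 1 ∧ d 3 = d 2 + 1 ∧ c 0 0 = 1 ∧ c 0 1 = d 2) ∨
  (d 1 = 2 ∧ c 0 0 = 2 ∧ c 0 1 = d 3 ∧ c 0 3 = d 2) ∨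
  (d 1 = 3 ∧ c 0 0 = 2 ∧ c 0 2 = d 3 ∧ c 0 3 = d 2) ∨
  (c 0 0 = 4 ∧ d 1 = 4 * c 0 1 + 4 ∧ c 0 2 = d 2 ∧
    c 1 0 = 2 ∧ c 1 1 = c 0 3 ∧ c 1 2 = c 0 4 ∧ c 1 3 = d 3) ∨
  (c 0 0 = 2 ∧ d 1 = 4 * c 0 3 + 6 ∧ c 1 0 = 3 ∧ c 1 1 = c 0 2 ∧ c 1 2 = d 2 ∧
    c 2 0 = 3 ∧ c 2 1 = c 0 1 ∧ c 2 2 = c 1 3 ∧ c 2 3 = d 3) ∨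
  (c 0 0 = 2 ∧ c 0 3 = d 2 ∧ c 1 0 = 5 ∧ d 1 = 4 * c 1 1 + 5 ∧
    c 1 2 = c 0 1 ∧ c 1 3 = c 0 2 ∧ c 1 4 = d 3) ∨
  (c 0 0 = 2 ∧ c 0 3 = d 2 ∧ c 1 0 = 8 ∧ d 1 = 4 * c 1 1 + 7 ∧
    c 1 2 = c 0 1 ∧ c 1 3 = c 0 2 ∧ c 1 4 = d 3)

/-- Both components of the pair `p` of codes are evaluated at `x`, with `d = (4, p, x, u, w)`. -/
def EvalBothClause : Prop :=
  c 0 0 = 2 ∧ c 0 3 = d 1 ∧ c 1 0 = 3 ∧ c 1 1 = c 0 1 ∧ c 1 2 = d 2 ∧ c 1 3 = d 3 ∧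
    c 2 0 = 3 ∧ c 2 1 = c 0 2 ∧ c 2 2 = d 2 ∧ c 2 3 = d 4

/-- Primitive recursion for the pair `p` of codes, with parameter `z`, recursion argument `n` and
value `y`, with `d = (5, p, z, n, y)`. -/
def PrecClause : Prop :=
  (d 3 = 0 ∧ c 0 0 = 2 ∧ c 0 3 = d 1 ∧ c 1 0 = 3 ∧ c 1 1 = c 0 1 ∧ c 1 2 = d 2 ∧ c 1 3 = d 4) ∨
  (c 0 0 = 5 ∧ c 0 1 = d 1 ∧ c 0 2 = d 2 ∧ d 3 = c 0 3 + 1 ∧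
    c 1 0 = 6 ∧ c 1 1 = d 2 ∧ c 1 2 = c 0 3 ∧ c 1 3 = c 0 4 ∧
    c 2 0 = 7 ∧ c 2 1 = d 1 ∧ c 2 2 = c 1 4 ∧ c 2 3 = d 4)

/-- `Nat.pair z (Nat.pair n w) = r`, with `d = (6, z, n, w, r)`. -/
def TripleClause : Prop :=
  c 0 0 = 2 ∧ c 0 1 = d 2 ∧ c 0 2 = d 3 ∧ c 1 0 = 2 ∧ c 1 1 = d 1 ∧ c 1 2 = c 0 3 ∧ c 1 3 = d 4

/-- The second component of the pair `p` of codes maps `x` to `y`, with `d = (7, p, x, y)`. -/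
def EvalSndClause : Prop :=
  c 0 0 = 2 ∧ c 0 3 = d 1 ∧ c 1 0 = 3 ∧ c 1 1 = c 0 2 ∧ c 1 2 = d 2 ∧ c 1 3 = d 3

/-- Search for the least zero `y ≥ m` of the code `e` with parameter `z`, with
`d = (8, e, z, m, y)`. -/
def RfindClause : Prop :=
  c 0 0 = 2 ∧ c 0 1 = d 2 ∧ c 0 2 = d 3 ∧ c 1 0 = 3 ∧ c 1 1 = d 1 ∧ c 1 2 = c 0 3 ∧
    ((c 1 3 = 0 ∧ d 4 = d 3) ∨
      (1 ≤ c 1 3 ∧ c 2 0 = 8 ∧ c 2 1 = d 1 ∧ c 2 2 = d 2 ∧ c 2 3 = d 3 + 1 ∧ c 2 4 = d 4))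

/-- The judgement `d` follows from the judgements `c 0`, `c 1` and `c 2` by one of the clauses.
The first entry of a judgement tells which relation it is about. -/
def Clause : Prop :=
  (d 0 = 1 ∧ SqClause d c) ∨ (d 0 = 2 ∧ PairClause d c) ∨ (d 0 = 3 ∧ EvalClause d c) ∨
  (d 0 = 4 ∧ EvalBothClause d c) ∨ (d 0 = 5 ∧ PrecClause d c) ∨ (d 0 = 6 ∧ TripleClause d c) ∨
  (d 0 = 7 ∧ EvalSndClause d c) ∨ (d 0 = 8 ∧ RfindClause d c)

end Clauses

/-- No clause multiplies two variables or uses a negation or a strict inequality, so the closure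
properties of `IsPL` and `IsPLPred` suffice. -/
theorem isPLPred_clause {m : ℕ} {d : (Fin m → ℝ) → Fin 5 → ℝ} {c : (Fin m → ℝ) → Fin 3 → Fin 5 → ℝ}
    (hd : ∀ k, IsPL fun x => d x k) (hc : ∀ r k, IsPL fun x => c x r k) :
    IsPLPred fun x => Clause (d x) (c x) := by
  unfold Clause SqClause PairClause EvalClause EvalBothClause PrecClause TripleClause EvalSndClause
    RfindClause
  repeat' first
    | exact hd _
    | exact hc _ _
    | exact IsPL.zero
    | exact IsPL.one
    | exact IsPL.ofNat _
    | apply IsPLPred.or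
    | apply IsPLPred.and
    | apply IsPLPred.eq
    | apply IsPLPred.le
    | apply IsPL.add
    | apply IsPL.ofNat_mul

/-! ### Soundness: derived judgements are true -/

section Soundness

open Nat.Partrec Nat.Partrec.Code

theorem encodeCode_injective : Function.Injective encodeCode :=
  encodeCode_eq ▸ Encodable.encode_injective

theorem exists_encodeCode_eq (n : ℕ) : ∃ c, encodeCode c = n :=
  ⟨Denumerable.ofNat Code n, Denumerable.encode_ofNat (α := Code) n⟩

theorem mem_eval_rfind' {f : Code} {z m y : ℕ} :
    y ∈ (rfind' f).eval (Nat.pair z m) ↔ ∃ k, y = k + m ∧ 0 ∈ f.eval (Nat.pair z (k + m)) ∧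
      ∀ j < k, ∃ u, u ≠ 0 ∧ u ∈ f.eval (Nat.pair z (j + m)) := by
  simp only [Code.eval, Nat.unpaired, Nat.unpair_pair, Part.mem_map_iff]
  constructor
  · rintro ⟨k, hk, rfl⟩
    obtain ⟨h0, h⟩ := Nat.mem_rfind.1 hk
    refine ⟨k, rfl, by simpa using h0, fun j hj => ?_⟩
    obtain ⟨u, hu, hu0⟩ := by simpa using h hj
    exact ⟨u, hu0, hu⟩
  · rintro ⟨k, rfl, h0, h⟩
    refine ⟨k, Nat.mem_rfind.2 ⟨by simpa using h0, fun {j} hj => ?_⟩, rfl⟩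
    obtain ⟨u, hu0, hu⟩ := h j hj
    simpa using ⟨u, hu, hu0⟩

theorem mem_eval_rfind'_of_zero {f : Code} {z m : ℕ} (h : 0 ∈ f.eval (Nat.pair z m)) :
    m ∈ (rfind' f).eval (Nat.pair z m) :=
  mem_eval_rfind'.2 ⟨0, by simp, by simpa using h, by simp⟩

theorem mem_eval_rfind'_of_succ {f : Code} {z m u y : ℕ} (h : u ∈ f.eval (Nat.pair z m))
    (hu : u ≠ 0) (hy : y ∈ (rfind' f).eval (Nat.pair z (m + 1))) :
    y ∈ (rfind' f).eval (Nat.pair z m) := by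
  obtain ⟨k, rfl, h0, hk⟩ := mem_eval_rfind'.1 hy
  refine mem_eval_rfind'.2 ⟨k + 1, by ring, by rwa [add_assoc, add_comm 1], ?_⟩
  rintro (_ | j) hj
  · exact ⟨u, hu, by simpa using h⟩
  · rw [add_assoc, add_comm 1]
    exact hk j (by omega)

theorem mem_eval_pair {f g : Code} {x u w : ℕ} (hu : u ∈ f.eval x) (hw : w ∈ g.eval x) :
    Nat.pair u w ∈ (Code.pair f g).eval x := by
  simp only [Code.eval, Seq.seq, Part.map_eq_map, Part.mem_bind_iff, Part.mem_map_iff]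
  exact ⟨_, ⟨u, hu, rfl⟩, w, hw, rfl⟩

theorem mem_eval_comp {f g : Code} {x u y : ℕ} (hu : u ∈ g.eval x) (hy : y ∈ f.eval u) :
    y ∈ (Code.comp f g).eval x :=
  Part.mem_bind hu hy

/-- The judgement `d` is about natural numbers, and true. -/
structure Sem (d : Fin 5 → ℝ) : Prop where
  sq : d 0 = 1 → ∃ n : ℕ, d 1 = n ∧ d 2 = (n * n : ℕ)
  pair : d 0 = 2 → ∃ a b : ℕ, d 1 = a ∧ d 2 = b ∧ d 3 = Nat.pair a b
  eval : d 0 = 3 → ∃ (e : Code) (x y : ℕ),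
    d 1 = encodeCode e ∧ d 2 = x ∧ d 3 = y ∧ y ∈ e.eval x
  evalBoth : d 0 = 4 → ∃ (f g : Code) (x u w : ℕ),
    d 1 = Nat.pair (encodeCode f) (encodeCode g) ∧ d 2 = x ∧ d 3 = u ∧ d 4 = w ∧
      u ∈ f.eval x ∧ w ∈ g.eval x
  prec : d 0 = 5 → ∃ (f g : Code) (z n y : ℕ),
    d 1 = Nat.pair (encodeCode f) (encodeCode g) ∧ d 2 = z ∧ d 3 = n ∧ d 4 = y ∧
      y ∈ (Code.prec f g).eval (Nat.pair z n)
  triple : d 0 = 6 → ∃ z n w : ℕ,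
    d 1 = z ∧ d 2 = n ∧ d 3 = w ∧ d 4 = Nat.pair z (Nat.pair n w)
  evalSnd : d 0 = 7 → ∃ (a : ℕ) (g : Code) (x y : ℕ),
    d 1 = Nat.pair a (encodeCode g) ∧ d 2 = x ∧ d 3 = y ∧ y ∈ g.eval x
  rfind : d 0 = 8 → ∃ (f : Code) (z m y : ℕ),
    d 1 = encodeCode f ∧ d 2 = z ∧ d 3 = m ∧ d 4 = y ∧ y ∈ (rfind' f).eval (Nat.pair z m)

/-- A missing child contributes the zero vector to the neighbourhood sum; its tag 0 names no
relation, so it claims nothing. -/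
theorem Sem.of_tag_eq_zero {d : Fin 5 → ℝ} (h : d 0 = 0) : Sem d := by
  constructor <;> intro h' <;> rw [h] at h' <;> norm_num at h'

variable {d : Fin 5 → ℝ} {c : Fin 3 → Fin 5 → ℝ}

theorem SqClause.sound (h : SqClause d c) (hc : ∀ r, Sem (c r)) :
    ∃ n : ℕ, d 1 = n ∧ d 2 = (n * n : ℕ) := by
  rcases h with ⟨h1, h2⟩ | ⟨h0, h1, h2⟩
  · exact ⟨0, by simpa using h1, by simpa using h2⟩
  · obtain ⟨n, e1, e2⟩ := (hc 0).sq h0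
    refine ⟨n + 1, by rw [h1, e1]; push_cast; ring, by rw [h2, e1, e2]; push_cast; ring⟩

theorem PairClause.sound (h : PairClause d c) (hc : ∀ r, Sem (c r)) :
    ∃ a b : ℕ, d 1 = a ∧ d 2 = b ∧ d 3 = Nat.pair a b := by
  obtain ⟨h0, h1, h2, h3, h⟩ := h
  obtain ⟨a, ea, ea'⟩ := (hc 0).sq h0
  obtain ⟨b, eb, eb'⟩ := (hc 1).sq h2
  refine ⟨a, b, h1 ▸ ea, h3 ▸ eb, ?_⟩
  rw [← h1, ← h3, ea, eb, ea', eb'] at h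
  rcases h with ⟨hle, h⟩ | ⟨hle, h⟩
  · have : a < b := by exact_mod_cast hle
    rw [h, Nat.pair, if_pos this]
    push_cast; ring
  · have : ¬ a < b := not_lt.2 (by exact_mod_cast hle)
    rw [h, Nat.pair, if_neg this]
    push_cast; ring

/-- The disjuncts match the constructors of `Code`; the affine forms 4p + 4, …, 4p + 7 are those by
which `encodeCode` numbers `pair`, `prec`, `comp` and `rfind'`. -/
theorem EvalClause.sound (h : EvalClause d c) (hc : ∀ r, Sem (c r)) :
    ∃ (e : Code) (x y : ℕ), d 1 = encodeCode e ∧ d 2 = x ∧ d 3 = y ∧ y ∈ e.eval x := by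
  rcases h with ⟨h1, h3, t0, h2⟩ | ⟨h1, h3, t0, h2⟩ | ⟨h1, t0, h3, h2⟩ | ⟨h1, t0, h3, h2⟩ |
    ⟨t0, h1, h2, t1, e1, e2, e3⟩ | ⟨t0, h1, t1, e1, e2, t2, e3, e4, e5⟩ |
    ⟨t0, h2, t1, h1, e1, e2, e3⟩ | ⟨t0, h2, t1, h1, e1, e2, e3⟩
  -- The square itself is irrelevant: this premise only certifies that the argument is a natural
  -- number.
  · obtain ⟨n, en, -⟩ := (hc 0).sq t0
    exact ⟨Code.zero, n, 0, by simpa [encodeCode] using h1, h2 ▸ en, by simpa using h3,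
      by simp [Code.eval, pure, PFun.pure]⟩
  · obtain ⟨n, en, -⟩ := (hc 0).sq t0
    exact ⟨Code.succ, n, n + 1, by simpa [encodeCode] using h1, h2 ▸ en,
      by rw [h3, ← h2, en]; push_cast; rfl, by simp [Code.eval]⟩
  · obtain ⟨a, b, ea, -, ex⟩ := (hc 0).pair t0
    exact ⟨Code.left, Nat.pair a b, a, by simpa [encodeCode] using h1, h2 ▸ ex, h3 ▸ ea,
      by simp [Code.eval]⟩
  · obtain ⟨a, b, -, eb, ex⟩ := (hc 0).pair t0
    exact ⟨Code.right, Nat.pair a b, b, by simpa [encodeCode] using h1, h2 ▸ ex, h3 ▸ eb,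
      by simp [Code.eval]⟩
  · obtain ⟨f, g, x, u, w, ep, ex, eu, ew, hu, hw⟩ := (hc 0).evalBoth t0
    obtain ⟨a, b, ea, eb, ey⟩ := (hc 1).pair t1
    obtain rfl : a = u := by exact_mod_cast (ea.symm.trans e1).trans eu
    obtain rfl : b = w := by exact_mod_cast (eb.symm.trans e2).trans ew
    refine ⟨Code.pair f g, x, Nat.pair a b, ?_, h2 ▸ ex, e3 ▸ ey, mem_eval_pair hu hw⟩
    rw [h1, ep, encodeCode]; push_cast; ring
  · obtain ⟨a, b, ea, eb, ep⟩ := (hc 0).pair t0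
    obtain ⟨g, x, u, eg, ex, eu, hu⟩ := (hc 1).eval t1
    obtain ⟨f, u', y, ef, eu', ey, hy⟩ := (hc 2).eval t2
    obtain rfl : encodeCode g = b := by exact_mod_cast (eg.symm.trans e1).trans eb
    obtain rfl : encodeCode f = a := by exact_mod_cast (ef.symm.trans e3).trans ea
    obtain rfl : u' = u := by exact_mod_cast (eu'.symm.trans e4).trans eu
    refine ⟨Code.comp f g, x, y, ?_, e2 ▸ ex, e5 ▸ ey, mem_eval_comp hu hy⟩
    rw [h1, ep, encodeCode]; push_cast; ring
  · obtain ⟨z, n, ez, en, ex⟩ := (hc 0).pair t0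
    obtain ⟨f, g, z', n', y, ep, ez', en', ey, hy⟩ := (hc 1).prec t1
    obtain rfl : z' = z := by exact_mod_cast (ez'.symm.trans e1).trans ez
    obtain rfl : n' = n := by exact_mod_cast (en'.symm.trans e2).trans en
    refine ⟨Code.prec f g, Nat.pair z' n', y, ?_, h2 ▸ ex, e3 ▸ ey, hy⟩
    rw [h1, ep, encodeCode]; push_cast; ring
  · obtain ⟨z, n, ez, en, ex⟩ := (hc 0).pair t0
    obtain ⟨f, z', n', y, ep, ez', en', ey, hy⟩ := (hc 1).rfind t1
    obtain rfl : z' = z := by exact_mod_cast (ez'.symm.trans e1).trans ez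
    obtain rfl : n' = n := by exact_mod_cast (en'.symm.trans e2).trans en
    refine ⟨Code.rfind' f, Nat.pair z' n', y, ?_, h2 ▸ ex, e3 ▸ ey, hy⟩
    rw [h1, ep, encodeCode]; push_cast; ring

theorem EvalBothClause.sound (h : EvalBothClause d c) (hc : ∀ r, Sem (c r)) :
    ∃ (f g : Code) (x u w : ℕ), d 1 = Nat.pair (encodeCode f) (encodeCode g) ∧ d 2 = x ∧
      d 3 = u ∧ d 4 = w ∧ u ∈ f.eval x ∧ w ∈ g.eval x := by
  obtain ⟨t0, h1, t1, e1, e2, e3, t2, e4, e5, e6⟩ := h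
  obtain ⟨a, b, ea, eb, ep⟩ := (hc 0).pair t0
  obtain ⟨f, x, u, ef, ex, eu, hu⟩ := (hc 1).eval t1
  obtain ⟨g, x', w, eg, ex', ew, hw⟩ := (hc 2).eval t2
  obtain rfl : encodeCode f = a := by exact_mod_cast (ef.symm.trans e1).trans ea
  obtain rfl : encodeCode g = b := by exact_mod_cast (eg.symm.trans e4).trans eb
  obtain rfl : x' = x := by exact_mod_cast (ex'.symm.trans e5).trans (e2 ▸ ex)
  exact ⟨f, g, x', u, w, h1 ▸ ep, e2 ▸ ex, e3 ▸ eu, e6 ▸ ew, hu, hw⟩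

theorem EvalSndClause.sound (h : EvalSndClause d c) (hc : ∀ r, Sem (c r)) :
    ∃ (a : ℕ) (g : Code) (x y : ℕ), d 1 = Nat.pair a (encodeCode g) ∧ d 2 = x ∧ d 3 = y ∧
      y ∈ g.eval x := by
  obtain ⟨t0, h1, t1, e1, e2, e3⟩ := h
  obtain ⟨a, b, ea, eb, ep⟩ := (hc 0).pair t0
  obtain ⟨g, x, y, eg, ex, ey, hy⟩ := (hc 1).eval t1
  obtain rfl : encodeCode g = b := by exact_mod_cast (eg.symm.trans e1).trans eb
  exact ⟨a, g, x, y, h1 ▸ ep, e2 ▸ ex, e3 ▸ ey, hy⟩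

theorem TripleClause.sound (h : TripleClause d c) (hc : ∀ r, Sem (c r)) :
    ∃ z n w : ℕ, d 1 = z ∧ d 2 = n ∧ d 3 = w ∧ d 4 = Nat.pair z (Nat.pair n w) := by
  obtain ⟨t0, e1, e2, t1, e3, e4, e5⟩ := h
  obtain ⟨n, w, en, ew, eq⟩ := (hc 0).pair t0
  obtain ⟨z, q, ez, eq', er⟩ := (hc 1).pair t1
  obtain rfl : q = Nat.pair n w := by exact_mod_cast (eq'.symm.trans e4).trans eq
  exact ⟨z, n, w, e3 ▸ ez, e1 ▸ en, e2 ▸ ew, e5 ▸ er⟩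

theorem PrecClause.sound (h : PrecClause d c) (hc : ∀ r, Sem (c r)) :
    ∃ (f g : Code) (z n y : ℕ), d 1 = Nat.pair (encodeCode f) (encodeCode g) ∧ d 2 = z ∧
      d 3 = n ∧ d 4 = y ∧ y ∈ (Code.prec f g).eval (Nat.pair z n) := by
  rcases h with ⟨h3, t0, h1, t1, e1, e2, e3⟩ |
    ⟨t0, h1, h2, h3, t1, e1, e2, e3, t2, e4, e5, e6⟩
  · obtain ⟨a, b, ea, eb, ep⟩ := (hc 0).pair t0
    obtain ⟨f, z, y, ef, ez, ey, hy⟩ := (hc 1).eval t1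
    obtain rfl : encodeCode f = a := by exact_mod_cast (ef.symm.trans e1).trans ea
    -- The base case never evaluates the second component, but every number encodes some program.
    obtain ⟨g, rfl⟩ := exists_encodeCode_eq b
    exact ⟨f, g, z, 0, y, h1 ▸ ep, e2 ▸ ez, by simpa using h3, e3 ▸ ey, by
      rwa [eval_prec_zero]⟩
  · obtain ⟨f, g, z, n, w, ep, ez, en, ew, hw⟩ := (hc 0).prec t0
    obtain ⟨z', n', w', ez', en', ew', er⟩ := (hc 1).triple t1
    obtain ⟨a, g', r, y, ep', er', ey, hy⟩ := (hc 2).evalSnd t2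
    obtain rfl : z' = z := by exact_mod_cast (ez'.symm.trans e1).trans (h2 ▸ ez)
    obtain rfl : n' = n := by exact_mod_cast (en'.symm.trans e2).trans en
    obtain rfl : w' = w := by exact_mod_cast (ew'.symm.trans e3).trans ew
    obtain rfl : r = Nat.pair z' (Nat.pair n' w') := by
      exact_mod_cast (er'.symm.trans e5).trans er
    have hp : Nat.pair a (encodeCode g') = Nat.pair (encodeCode f) (encodeCode g) := by
      exact_mod_cast (ep'.symm.trans e4).trans (h1 ▸ ep)
    obtain rfl : g' = g := encodeCode_injective (Nat.pair_eq_pair.1 hp).2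
    refine ⟨f, g', z', n' + 1, y, h1 ▸ ep, h2 ▸ ez, ?_, e6 ▸ ey, ?_⟩
    · rw [h3, en]; push_cast; rfl
    · rw [← Nat.succ_eq_add_one, eval_prec_succ]
      exact Part.mem_bind hw hy

theorem RfindClause.sound (h : RfindClause d c) (hc : ∀ r, Sem (c r)) :
    ∃ (f : Code) (z m y : ℕ), d 1 = encodeCode f ∧ d 2 = z ∧ d 3 = m ∧ d 4 = y ∧
      y ∈ (rfind' f).eval (Nat.pair z m) := by
  obtain ⟨t0, e1, e2, t1, e3, e4, h⟩ := h
  obtain ⟨z, m, ez, em, ex⟩ := (hc 0).pair t0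
  obtain ⟨f, x, u, ef, ex', eu, hu⟩ := (hc 1).eval t1
  obtain rfl : x = Nat.pair z m := by exact_mod_cast (ex'.symm.trans e4).trans ex
  rw [eu] at h
  rcases h with ⟨h0, h4⟩ | ⟨hpos, t2, e5, e6, e7, e8⟩
  · obtain rfl : u = 0 := by exact_mod_cast h0
    exact ⟨f, z, m, m, e3 ▸ ef, e1 ▸ ez, e2 ▸ em, by rw [h4, ← e2, em],
      mem_eval_rfind'_of_zero hu⟩
  · obtain ⟨f', z', m', y, ef', ez', em', ey, hy⟩ := (hc 2).rfind t2
    have hff : encodeCode f' = encodeCode f := by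
      exact_mod_cast (ef'.symm.trans e5).trans (e3 ▸ ef)
    obtain rfl := encodeCode_injective hff
    obtain rfl : z' = z := by exact_mod_cast (ez'.symm.trans e6).trans (e1 ▸ ez)
    obtain rfl : m' = m + 1 := by
      rw [em', ← e2, em] at e7
      exact_mod_cast e7
    have hu0 : u ≠ 0 := by
      have : 1 ≤ u := by exact_mod_cast hpos
      omega
    exact ⟨f', z', m, y, e3 ▸ ef, e1 ▸ ez, e2 ▸ em, e8 ▸ ey, mem_eval_rfind'_of_succ hu hu0 hy⟩

theorem Clause.sound (h : Clause d c) (hc : ∀ r, Sem (c r)) : Sem d := by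
  rcases h with ⟨t, h⟩ | ⟨t, h⟩ | ⟨t, h⟩ | ⟨t, h⟩ | ⟨t, h⟩ | ⟨t, h⟩ | ⟨t, h⟩ | ⟨t, h⟩ <;>
    constructor <;> intro t' <;>
    first
    | exact h.sound hc
    | (rw [t] at t'; norm_num at t')

end Soundness

/-! ### Derivation trees -/

/-- Trees of judgements about natural numbers. -/
inductive DTree
  | nil
  | node (d : Fin 5 → ℕ) (ch : Fin 3 → DTree)

namespace DTree

/-- The judgement at the root. -/
def root : DTree → Fin 5 → ℕ
  | nil => 0
  | node d _ => d

/-- The height of a tree, or rather an upper bound for it. -/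
def height : DTree → ℕ
  | nil => 0
  | node _ ch => (∑ r, (ch r).height) + 1

/-- Each node of the tree is justified by its children through a clause. -/
def Valid : DTree → Prop
  | nil => True
  | node d ch => Clause (fun k => d k) (fun r k => (ch r).root k) ∧ ∀ r, (ch r).Valid

end DTree

/-- The judgement `d` has a derivation. -/
def Derivable (d : Fin 5 → ℕ) : Prop := ∃ t : DTree, t.Valid ∧ t.root = d

/-! ### Completeness: true evaluations are derivable -/

section Completeness

open Nat.Partrec Nat.Partrec.Code

/-- The empty tree fills the places of unused premises. -/
theorem Derivable.zero : Derivable 0 := ⟨.nil, trivial, rfl⟩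

theorem Derivable.of_clause {d c₀ c₁ c₂ : Fin 5 → ℕ} (h₀ : Derivable c₀) (h₁ : Derivable c₁)
    (h₂ : Derivable c₂)
    (h : Clause (fun k => d k) ![fun k => c₀ k, fun k => c₁ k, fun k => c₂ k]) : Derivable d := by
  obtain ⟨t₀, v₀, rfl⟩ := h₀
  obtain ⟨t₁, v₁, rfl⟩ := h₁
  obtain ⟨t₂, v₂, rfl⟩ := h₂
  refine ⟨.node d ![t₀, t₁, t₂], ⟨?_, ?_⟩, rfl⟩
  · convert h using 2 with r
    fin_cases r <;> rfl
  · intro r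
    fin_cases r <;> assumption

theorem derivable_sq (n : ℕ) : Derivable ![1, n, n * n, 0, 0] := by
  induction n with
  | zero =>
    refine .of_clause .zero .zero .zero ?_
    simp [Clause, SqClause]
  | succ n ih =>
    refine .of_clause ih .zero .zero ?_
    simp [Clause, SqClause]
    right; ring

theorem derivable_pair (a b : ℕ) : Derivable ![2, a, b, Nat.pair a b, 0] := by
  refine .of_clause (derivable_sq a) (derivable_sq b) .zero ?_
  simp only [Clause, PairClause]
  simp
  rcases lt_or_ge a b with h | h
  · left
    refine ⟨by exact_mod_cast h, ?_⟩
    rw [Nat.pair, if_pos h]; push_cast; ring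
  · right
    refine ⟨by exact_mod_cast h, ?_⟩
    rw [Nat.pair, if_neg (not_lt.2 h)]; push_cast; ring

theorem derivable_triple (z n w : ℕ) : Derivable ![6, z, n, w, Nat.pair z (Nat.pair n w)] := by
  refine .of_clause (derivable_pair n w) (derivable_pair z (Nat.pair n w)) .zero ?_
  simp [Clause, TripleClause]

variable {f g : Code}

/-- Each true evaluation of the code `e` is derivable. -/
def EvalDerivable (e : Code) : Prop :=
  ∀ x y, y ∈ e.eval x → Derivable ![3, encodeCode e, x, y, 0]

theorem evalDerivable_pair (hf : EvalDerivable f) (hg : EvalDerivable g) :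
    EvalDerivable (Code.pair f g) := by
  intro x y hy
  simp only [Code.eval, Seq.seq, Part.map_eq_map, Part.mem_bind_iff, Part.mem_map_iff] at hy
  obtain ⟨_, ⟨u, hu, rfl⟩, w, hw, rfl⟩ := hy
  -- The rule for `pair` would need four premises; an auxiliary judgement keeps the branching at
  -- three.
  have h : Derivable ![4, Nat.pair (encodeCode f) (encodeCode g), x, u, w] := by
    refine .of_clause (derivable_pair (encodeCode f) (encodeCode g)) (hf _ _ hu) (hg _ _ hw) ?_
    simp [Clause, EvalBothClause]
  refine .of_clause h (derivable_pair u w) .zero ?_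
  simp [Clause, EvalClause, encodeCode]
  ring

theorem evalDerivable_comp (hf : EvalDerivable f) (hg : EvalDerivable g) :
    EvalDerivable (Code.comp f g) := by
  intro x y hy
  obtain ⟨u, hu, hy⟩ := Part.mem_bind_iff.1 hy
  refine .of_clause (derivable_pair (encodeCode f) (encodeCode g)) (hg _ _ hu) (hf _ _ hy) ?_
  simp [Clause, EvalClause, encodeCode]
  ring_nf
  simp

theorem derivable_prec (hf : EvalDerivable f) (hg : EvalDerivable g) (z n y : ℕ)
    (hy : y ∈ (Code.prec f g).eval (Nat.pair z n)) :
    Derivable ![5, Nat.pair (encodeCode f) (encodeCode g), z, n, y] := by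
  induction n generalizing y with
  | zero =>
    rw [eval_prec_zero] at hy
    refine .of_clause (derivable_pair (encodeCode f) (encodeCode g)) (hf _ _ hy) .zero ?_
    simp [Clause, PrecClause]
  | succ n ih =>
    rw [← Nat.succ_eq_add_one, eval_prec_succ] at hy
    obtain ⟨w, hw, hy⟩ := Part.mem_bind_iff.1 hy
    have h : Derivable ![7, Nat.pair (encodeCode f) (encodeCode g),
        Nat.pair z (Nat.pair n w), y, 0] := by
      refine .of_clause (derivable_pair (encodeCode f) (encodeCode g)) (hg _ _ hy) .zero ?_
      simp [Clause, EvalSndClause]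
    refine .of_clause (ih w hw) (derivable_triple z n w) h ?_
    simp [Clause, PrecClause]

theorem evalDerivable_prec (hf : EvalDerivable f) (hg : EvalDerivable g) :
    EvalDerivable (Code.prec f g) := by
  intro x y hy
  obtain ⟨⟨z, n⟩, rfl⟩ := Nat.pairEquiv.surjective x
  refine .of_clause (derivable_pair z n) (derivable_prec hf hg z n y hy) .zero ?_
  simp [Clause, EvalClause, encodeCode]
  ring_nf
  simp

theorem derivable_rfind (hf : EvalDerivable f) (z m y : ℕ)
    (hy : y ∈ (rfind' f).eval (Nat.pair z m)) : Derivable ![8, encodeCode f, z, m, y] := by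
  obtain ⟨k, rfl, h0, hk⟩ := mem_eval_rfind'.1 hy
  clear hy
  -- Induction on the number of failed tests; the starting point `m` moves up by one each time.
  induction k generalizing m with
  | zero =>
    rw [zero_add] at h0
    refine .of_clause (derivable_pair z m) (hf _ _ h0) .zero ?_
    simp [Clause, RfindClause]
  | succ k ih =>
    obtain ⟨u, hu0, hu⟩ := hk 0 k.succ_pos
    rw [zero_add] at hu
    have h := ih (m + 1) (by rwa [add_comm m, ← add_assoc]) fun j hj => by
      rw [add_comm m, ← add_assoc]
      exact hk (j + 1) (by omega)
    refine .of_clause (derivable_pair z m) (hf _ _ hu) h ?_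
    simp [Clause, RfindClause]
    right
    exact ⟨by exact_mod_cast Nat.one_le_iff_ne_zero.2 hu0, by ring⟩

theorem evalDerivable_rfind' (hf : EvalDerivable f) : EvalDerivable (rfind' f) := by
  intro x y hy
  obtain ⟨⟨z, m⟩, rfl⟩ := Nat.pairEquiv.surjective x
  refine .of_clause (derivable_pair z m) (derivable_rfind hf z m y hy) .zero ?_
  simp [Clause, EvalClause, encodeCode]
  ring_nf
  simp

theorem evalDerivable (e : Code) : EvalDerivable e := by
  induction e with
  | zero =>
    intro x y hy
    obtain rfl : y = 0 := by simpa [Code.eval, pure, PFun.pure] using hy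
    refine .of_clause (derivable_sq x) .zero .zero ?_
    simp [Clause, EvalClause, encodeCode]
  | succ =>
    intro x y hy
    obtain rfl : y = x + 1 := by simpa [Code.eval] using hy
    refine .of_clause (derivable_sq x) .zero .zero ?_
    simp [Clause, EvalClause, encodeCode]
  | left =>
    intro x y hy
    obtain rfl : y = x.unpair.1 := by simpa [Code.eval] using hy
    refine .of_clause (derivable_pair x.unpair.1 x.unpair.2) .zero .zero ?_
    simp [Clause, EvalClause, encodeCode]
  | right =>
    intro x y hy
    obtain rfl : y = x.unpair.2 := by simpa [Code.eval] using hy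
    refine .of_clause (derivable_pair x.unpair.1 x.unpair.2) .zero .zero ?_
    simp [Clause, EvalClause, encodeCode]
  | pair f g hf hg => exact evalDerivable_pair hf hg
  | comp f g hf hg => exact evalDerivable_comp hf hg
  | prec f g hf hg => exact evalDerivable_prec hf hg
  | rfind' f hf => exact evalDerivable_rfind' hf

end Completeness

/-! ### Derivations as graphs

A node carries a record of nine numbers, a judgement followed by an upper bound for the height of
the derivation, the number `1`, a flag that marks the root, and the number that the derivation is
about in case of the root. The record is stored in one of seven slots of the label, such that the
slots of the children and of the parent of a node are all distinct. -/

/-- The judgement stored in a record. -/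
def judgement (x : Fin 9 → ℝ) : Fin 5 → ℝ := fun k => x (Fin.castAdd 4 k)

/-- The differences between the slots of the children and the slot of their parent. -/
def slotShift : Fin 3 → Fin 7 := ![1, 2, 4]

theorem slotShift_injective : Function.Injective slotShift := by decide

/-- The parent of a node in slot s sits in slot s - `slotShift r'`. This rules out that it is taken
for a child: 1, 2, 4 are the non-zero squares modulo 7, and -1 is not a square. -/
theorem slotShift_add_ne_zero : ∀ r r' : Fin 3, slotShift r + slotShift r' ≠ 0 := by decide

/-- The condition on the root flag: a root is about an evaluation at the argument zero. -/
def RootCondition (x : Fin 9 → ℝ) : Prop :=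
  (x 7 = 0 ∧ x 8 = 0) ∨ (x 7 = 1 ∧ x 0 = 3 ∧ x 2 = 0 ∧ 0 ≤ x 8 ∧ x 8 = x 1 + 1)

/-- The condition on the label of a node and the sum of the labels of its neighbours. -/
def LocallyValid (own nb : Fin 7 → Fin 9 → ℝ) : Prop :=
  ∃ s, (∀ s', s' ≠ s → ∀ k, own s' k = 0) ∧ own s 6 = 1 ∧ 0 ≤ own s 5 ∧
    (∀ r, nb (s + slotShift r) 6 ≤ 1) ∧ (∀ r, nb (s + slotShift r) 5 + 1 ≤ own s 5) ∧
    Clause (judgement (own s)) (fun r => judgement (nb (s + slotShift r))) ∧ RootCondition (own s)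

theorem isPLPred_locallyValid {m : ℕ} {own nb : (Fin m → ℝ) → Fin 7 → Fin 9 → ℝ}
    (hown : ∀ s k, IsPL fun x => own x s k) (hnb : ∀ s k, IsPL fun x => nb x s k) :
    IsPLPred fun x => LocallyValid (own x) (nb x) := by
  refine IsPLPred.any fun s => ?_
  refine (IsPLPred.all fun s' => IsPLPred.imp <| IsPLPred.all fun k => .eq (hown _ _) .zero).and ?_
  refine (IsPLPred.eq (hown _ _) .one).and ?_
  refine (IsPLPred.le .zero (hown _ _)).and ?_
  refine (IsPLPred.all fun r => .le (hnb _ _) .one).and ?_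
  refine (IsPLPred.all fun r => .le ((hnb _ _).add .one) (hown _ _)).and ?_
  refine (isPLPred_clause (fun k => hown _ _) fun r k => hnb _ _).and ?_
  refine ((IsPLPred.eq (hown _ _) .zero).and (.eq (hown _ _) .zero)).or ?_
  exact (IsPLPred.eq (hown _ _) .one).and <| (IsPLPred.eq (hown _ _) (.ofNat 3)).and <|
    (IsPLPred.eq (hown _ _) .zero).and <| (IsPLPred.le .zero (hown _ _)).and <|
    .eq (hown _ _) ((hown _ _).add .one)

/-- Ensures that the final ReLU of the combination network leaves the root flag and the root number
unchanged. -/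
theorem LocallyValid.sum_nonneg {own nb : Fin 7 → Fin 9 → ℝ} (h : LocallyValid own nb) :
    0 ≤ ∑ s, own s 7 ∧ 0 ≤ ∑ s, own s 8 := by
  obtain ⟨s, h0, -, -, -, -, -, h⟩ := h
  rw [Finset.sum_eq_single_of_mem s (Finset.mem_univ s) fun s' _ hs => h0 s' hs 7,
    Finset.sum_eq_single_of_mem s (Finset.mem_univ s) fun s' _ hs => h0 s' hs 8]
  rcases h with ⟨h7, h8⟩ | ⟨h7, -, -, h8, -⟩
  · exact ⟨h7.ge, h8.ge⟩
  · exact ⟨h7 ▸ zero_le_one, h8⟩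

/-! ### From locally valid graphs to halting programs -/

namespace LGraph

/-- The position of the entry `k` of the slot `s` in a label. -/
def slotIndex : Fin 7 × Fin 9 ≃ Fin 63 := finProdFinEquiv

/-- The records in the slots of a node. -/
def slots (G : LGraph 63) (v : G.V) (s : Fin 7) (k : Fin 9) : ℝ :=
  G.label v (slotIndex (s, k))

/-- The sums of the records of the neighbours. -/
noncomputable def neighSlots (G : LGraph 63) (v : G.V) (s : Fin 7) (k : Fin 9) : ℝ :=
  ∑ w ∈ G.neigh v, G.slots w s k

variable {G : LGraph 63}

/-- Each node has a 1 in entry 6 of its own slot and zeros in all other slots, so the sum of entries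
6 counts the neighbours using slot `s`. If the count is at most 1, the sum of records is a single
record or zero. -/
theorem neighSlots_eq_zero_or {sl : G.V → Fin 7} (h0 : ∀ v s, s ≠ sl v → ∀ k, G.slots v s k = 0)
    (h1 : ∀ v, G.slots v (sl v) 6 = 1) (v : G.V) (s : Fin 7) (h : G.neighSlots v s 6 ≤ 1) :
    G.neighSlots v s = 0 ∨ ∃ w, sl w = s ∧ G.neighSlots v s = G.slots w s := by
  classical
  have key : ∀ k, G.neighSlots v s k =
      ∑ w ∈ (G.neigh v).filter (fun w => sl w = s), G.slots w s k := by
    intro k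
    rw [Finset.sum_filter_of_ne]
    · rfl
    · intro w _ hw
      by_contra hs
      exact hw (h0 w s (Ne.symm hs) k)
  have hcard : ((G.neigh v).filter fun w => sl w = s).card ≤ 1 := by
    rw [key, Finset.sum_congr rfl (g := fun _ => (1 : ℝ))] at h
    · simpa using h
    · intro w hw
      rw [← (Finset.mem_filter.1 hw).2, h1]
  rcases Finset.eq_empty_or_nonempty ((G.neigh v).filter fun w => sl w = s) with he | ⟨w, hw⟩
  · left
    ext k
    rw [key, he]
    simp
  · right
    refine ⟨w, (Finset.mem_filter.1 hw).2, ?_⟩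
    have he : (G.neigh v).filter (fun w => sl w = s) = {w} :=
      Finset.eq_singleton_iff_unique_mem.2
        ⟨hw, fun x hx => Finset.card_le_one.1 hcard x hx w hw⟩
    ext k
    rw [key, he, Finset.sum_singleton]

/-- Induction on an integer bound for the counter in entry 5, which is real-valued but non-negative
and falls by at least 1 towards each child. No acyclicity of the graph is needed. -/
theorem sem_of_locallyValid (h : ∀ v, LocallyValid (G.slots v) (G.neighSlots v)) (v : G.V)
    (s : Fin 7) (hs : G.slots v s 6 = 1) : Sem (judgement (G.slots v s)) := by
  choose sl h0 h1 hpos hle hfuel hcl _ using h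
  have main : ∀ (n : ℕ) (v : G.V), G.slots v (sl v) 5 < n →
      Sem (judgement (G.slots v (sl v))) := by
    intro n
    induction n with
    | zero =>
      intro v hv
      have := hpos v
      norm_num at hv
      linarith
    | succ n ih =>
      intro v hv
      refine (hcl v).sound fun r => ?_
      rcases neighSlots_eq_zero_or h0 h1 v _ (hle v r) with hz | ⟨w, hw, he⟩
      · exact Sem.of_tag_eq_zero (by rw [hz]; rfl)
      · have hf := hfuel v r
        rw [he, ← hw] at hf ⊢
        refine ih w ?_
        push_cast at hv
        linarith
  obtain rfl : s = sl v := by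
    by_contra hne
    rw [h0 v s hne] at hs
    norm_num at hs
  obtain ⟨n, hn⟩ := exists_nat_gt (G.slots v (sl v) 5)
  exact main n v hn

open Nat.Partrec.Code in
/-- If all nodes of a graph satisfy the local condition and there is exactly one root, then the
program that the root is about halts. -/
theorem exists_code_of_locallyValid (h : ∀ v, LocallyValid (G.slots v) (G.neighSlots v)) {n : ℕ}
    (hflag : ∑ v, ∑ s, G.slots v s 7 = 1) (hval : ∑ v, ∑ s, G.slots v s 8 = n + 1) :
    ∃ e : Nat.Partrec.Code, encodeCode e = n ∧ (e.eval 0).Dom := by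
  have hsem := sem_of_locallyValid h
  choose sl h0 h1 _ _ _ _ hroot using h
  have hsum : ∀ v k, ∑ s, G.slots v s k = G.slots v (sl v) k := fun v k =>
    Finset.sum_eq_single_of_mem _ (Finset.mem_univ _) fun s _ hs => h0 v s hs k
  simp only [hsum] at hflag hval
  obtain ⟨v, hv⟩ : ∃ v, G.slots v (sl v) 7 ≠ 0 := by
    by_contra! hz
    simp [hz] at hflag
  -- Flags are 0 or 1 and sum to 1, so the root is unique; otherwise the numbers of several roots
  -- could add up to the desired value.
  have hone : ∀ w, w ≠ v → G.slots w (sl w) 7 = 0 := by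
    have hnn : ∀ w, 0 ≤ G.slots w (sl w) 7 := fun w => by
      rcases hroot w with ⟨h, -⟩ | ⟨h, -⟩ <;> rw [h]
      exact zero_le_one
    have hv1 : G.slots v (sl v) 7 = 1 := by
      rcases hroot v with ⟨h, -⟩ | ⟨h, -⟩
      · exact absurd h hv
      · exact h
    classical
    rw [← Finset.add_sum_erase _ _ (Finset.mem_univ v), hv1, add_eq_left,
      Finset.sum_eq_zero_iff_of_nonneg fun w _ => hnn w] at hflag
    exact fun w hw => hflag w (Finset.mem_erase.2 ⟨hw, Finset.mem_univ w⟩)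
  rw [Finset.sum_eq_single_of_mem v (Finset.mem_univ v)] at hval
  swap
  · intro w _ hw
    rcases hroot w with ⟨-, h⟩ | ⟨h, -⟩
    · exact h
    · rw [hone w hw] at h
      norm_num at h
  rcases hroot v with ⟨h, -⟩ | ⟨-, htag, harg, -, h8⟩
  · exact absurd h hv
  · obtain ⟨e, x, y, he, hx, -, hy⟩ := (hsem v _ (h1 v)).eval htag
    have he' : G.slots v (sl v) 1 = encodeCode e := he
    have hx' : G.slots v (sl v) 2 = x := hx
    rw [harg] at hx'
    obtain rfl : x = 0 := by exact_mod_cast hx'.symm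
    rw [h8, he', add_left_inj] at hval
    exact ⟨e, by exact_mod_cast hval, Part.dom_iff_mem.2 ⟨y, hy⟩⟩

end LGraph

/-! ### The graph of a derivation tree -/

namespace DTree

/-- The subtree at a child of the root. -/
def child : DTree → Fin 3 → DTree
  | nil, _ => nil
  | node _ ch, r => ch r

/-- The subtree at the end of a path from the root. -/
def subtree (t : DTree) (p : List (Fin 3)) : DTree := p.foldl child t

theorem subtree_concat (t : DTree) (p : List (Fin 3)) (r : Fin 3) :
    t.subtree (p ++ [r]) = (t.subtree p).child r := by
  simp [subtree, List.foldl_append]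

theorem Valid.child {t : DTree} (h : t.Valid) (r : Fin 3) : (t.child r).Valid := by
  cases t with
  | nil => trivial
  | node d ch => exact h.2 r

theorem Valid.subtree {t : DTree} (h : t.Valid) (p : List (Fin 3)) : (t.subtree p).Valid := by
  induction p generalizing t with
  | nil => exact h
  | cons r p ih => exact ih (h.child r)

theorem Valid.clause {t : DTree} (h : t.Valid) (hne : t ≠ nil) :
    Clause (fun k => t.root k) (fun r k => (t.child r).root k) := by
  cases t with
  | nil => exact absurd rfl hne
  | node d ch => exact h.1

theorem height_child_lt {t : DTree} (hne : t ≠ nil) (r : Fin 3) :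
    (t.child r).height + 1 ≤ t.height := by
  cases t with
  | nil => exact absurd rfl hne
  | node d ch =>
    exact Nat.succ_le_succ (Finset.single_le_sum (f := fun r => (ch r).height)
      (fun _ _ => Nat.zero_le _) (Finset.mem_univ r))

theorem subtree_nil (p : List (Fin 3)) : nil.subtree p = nil := by
  induction p with
  | nil => rfl
  | cons r p ih => exact ih

/-- Bounds the paths to non-empty subtrees, which makes the vertex set finite. -/
theorem length_le_height {t : DTree} {p : List (Fin 3)} (h : t.subtree p ≠ nil) :
    p.length ≤ t.height := by
  induction p generalizing t with
  | nil => exact Nat.zero_le _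
  | cons r p ih =>
    have hne : t ≠ nil := by
      rintro rfl
      exact h (subtree_nil _)
    exact (Nat.succ_le_succ (ih h)).trans (height_child_lt hne r)

/-- The nodes of a tree. -/
def Pos (t : DTree) : Type := {p : List (Fin 3) // t.subtree p ≠ nil}

instance (t : DTree) : Finite t.Pos :=
  ((List.finite_length_le (Fin 3) t.height).subset fun _ h => length_le_height h).to_subtype

/-- The slot used by a node. -/
def slot (p : List (Fin 3)) : Fin 7 := (p.map slotShift).sum

theorem slot_concat (p : List (Fin 3)) (r : Fin 3) : slot (p ++ [r]) = slot p + slotShift r := by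
  simp [slot]

/-- The record of a node. -/
def record (t : DTree) (p : List (Fin 3)) : Fin 9 → ℕ :=
  Fin.append (t.subtree p).root
    ![(t.subtree p).height, 1, if p = [] then 1 else 0, if p = [] then t.root 1 + 1 else 0]

theorem judgement_record (t : DTree) (p : List (Fin 3)) :
    judgement (fun k => t.record p k) = fun k => ((t.subtree p).root k : ℝ) := by
  ext k
  simp only [judgement, record]
  rw [Fin.append_left]

/-- The graph of a tree. -/
noncomputable def graph (t : DTree) : LGraph 63 where
  V := t.Pos
  fin := Fintype.ofFinite _
  Adj p q := (∃ r, q.1 = p.1 ++ [r]) ∨ ∃ r, p.1 = q.1 ++ [r]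
  symm _ _ h := h.symm
  label p i := if (LGraph.slotIndex.symm i).1 = slot p.1 then
    (t.record p.1 (LGraph.slotIndex.symm i).2 : ℝ) else 0

variable {t : DTree}

/-- The path from the root to a node. -/
def path (p : t.graph.V) : List (Fin 3) := (show t.Pos from p).1

theorem subtree_path_ne_nil (p : t.graph.V) : t.subtree (path p) ≠ nil := (show t.Pos from p).2

theorem path_injective : Function.Injective (path (t := t)) := Subtype.val_injective

theorem exists_path_eq {p : List (Fin 3)} (h : t.subtree p ≠ nil) : ∃ q : t.graph.V, path q = p :=
  ⟨(⟨p, h⟩ : t.Pos), rfl⟩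

open Classical in
theorem mem_neigh_graph {p q : t.graph.V} :
    q ∈ t.graph.neigh p ↔ (∃ r, path q = path p ++ [r]) ∨ ∃ r, path p = path q ++ [r] := by
  exact Finset.mem_filter_univ _

theorem slots_graph (p : t.graph.V) (s : Fin 7) (k : Fin 9) :
    t.graph.slots p s k = if s = slot (path p) then (t.record (path p) k : ℝ) else 0 := by
  change (if (LGraph.slotIndex.symm (LGraph.slotIndex (s, k))).1 = slot (path p) then
    (t.record (path p) (LGraph.slotIndex.symm (LGraph.slotIndex (s, k))).2 : ℝ) else 0) = _
  rw [Equiv.symm_apply_apply]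

theorem slots_graph_self (p : t.graph.V) :
    t.graph.slots p (slot (path p)) = fun k => (t.record (path p) k : ℝ) := by
  ext k
  rw [slots_graph, if_pos rfl]

/-- Another child has a different shift, and the parent would need two shifts with sum zero. -/
theorem eq_of_mem_neigh_graph {p q : t.graph.V} {r : Fin 3} (h : q ∈ t.graph.neigh p)
    (hs : slot (path p) + slotShift r = slot (path q)) : path q = path p ++ [r] := by
  rcases mem_neigh_graph.1 h with ⟨r', h⟩ | ⟨r', h⟩
  · rw [h, slot_concat, add_right_inj] at hs
    rw [h, slotShift_injective hs]
  · rw [h, slot_concat, add_assoc, add_eq_left] at hs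
    exact absurd hs (slotShift_add_ne_zero _ _)

open Classical in
theorem neighSlots_graph (p : t.graph.V) (r : Fin 3) :
    t.graph.neighSlots p (slot (path p) + slotShift r) =
      if (t.subtree (path p)).child r = nil then 0 else
        fun k => (t.record (path p ++ [r]) k : ℝ) := by
  ext k
  rw [LGraph.neighSlots]
  split_ifs with h
  · refine Finset.sum_eq_zero fun q hq => ?_
    rw [slots_graph, if_neg]
    intro hs
    refine subtree_path_ne_nil q ?_
    rw [eq_of_mem_neigh_graph hq hs, subtree_concat, h]
  · obtain ⟨q, hq⟩ := exists_path_eq (t := t) (p := path p ++ [r]) (by rwa [subtree_concat])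
    rw [Finset.sum_eq_single_of_mem q (mem_neigh_graph.2 (Or.inl ⟨r, hq⟩))]
    · rw [slots_graph, hq, if_pos (slot_concat _ _).symm]
    · intro q' hq' hne
      rw [slots_graph, if_neg]
      intro hs
      exact hne (path_injective ((eq_of_mem_neigh_graph hq' hs).trans hq.symm))

theorem degreeLE_graph (t : DTree) : t.graph.DegreeLE 4 := by
  intro p
  rw [← Finset.card_map (⟨path, path_injective⟩ : t.graph.V ↪ List (Fin 3))]
  refine le_trans (Finset.card_le_card
    (t := {path p ++ [0], path p ++ [1], path p ++ [2], (path p).dropLast}) ?_) Finset.card_le_four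
  intro l hl
  obtain ⟨q, hq, rfl⟩ := Finset.mem_map.1 hl
  simp only [Function.Embedding.coeFn_mk, Finset.mem_insert, Finset.mem_singleton]
  rcases mem_neigh_graph.1 hq with ⟨r, h⟩ | ⟨r, h⟩
  · fin_cases r <;> simp [h]
  · simp [h]

theorem natLabelled_graph (t : DTree) : t.graph.NatLabelled := by
  intro p i
  by_cases h : (LGraph.slotIndex.symm i).1 = slot (path p)
  · exact ⟨_, if_pos h⟩
  · exact ⟨0, (if_neg h).trans Nat.cast_zero.symm⟩

theorem rootCondition_record {n y : ℕ} (ht : t.root = ![3, n, 0, y, 0]) (p : List (Fin 3)) :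
    RootCondition fun k => t.record p k := by
  by_cases hp : p = []
  · subst hp
    right
    refine ⟨by simp [record, Fin.append, Fin.addCases], ?_⟩
    simp [record, Fin.append, Fin.addCases, subtree, ht]
    positivity
  · left
    simp [record, Fin.append, Fin.addCases, hp]

theorem record_five (t : DTree) (p : List (Fin 3)) : t.record p 5 = (t.subtree p).height := rfl

theorem record_six (t : DTree) (p : List (Fin 3)) : t.record p 6 = 1 := rfl

theorem locallyValid_graph (hv : t.Valid) {n y : ℕ} (ht : t.root = ![3, n, 0, y, 0])
    (p : t.graph.V) : LocallyValid (t.graph.slots p) (t.graph.neighSlots p) := by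
  refine ⟨slot (path p), fun s hs k => by rw [slots_graph, if_neg hs], ?_, ?_, fun r => ?_,
    fun r => ?_, ?_, ?_⟩
  · simp only [slots_graph_self, record_six, Nat.cast_one]
  · rw [slots_graph_self]
    exact Nat.cast_nonneg _
  · rw [neighSlots_graph]
    split_ifs
    · exact zero_le_one
    · simp only [record_six, Nat.cast_one, le_refl]
  · rw [neighSlots_graph, slots_graph_self]
    have := height_child_lt (subtree_path_ne_nil p) r
    split_ifs
    -- Even for a missing child the counter must be at least 1, which holds because non-empty trees
    -- have positive height.
    · simp only [Pi.zero_apply, zero_add, record_five]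
      exact_mod_cast (Nat.le_add_left 1 _).trans this
    · simp only [record_five, subtree_concat]
      exact_mod_cast this
  · rw [slots_graph_self, judgement_record]
    convert (hv.subtree (path p)).clause (subtree_path_ne_nil p) using 2 with r
    rw [neighSlots_graph]
    split_ifs with h
    · rw [h]
      ext k
      simp [judgement, root]
    · rw [judgement_record, subtree_concat]
  · rw [slots_graph_self]
    exact rootCondition_record ht (path p)

theorem sum_slots_graph (k : Fin 9) (hk : ∀ p, p ≠ [] → t.record p k = 0) (hne : t ≠ nil) :
    ∑ v, ∑ s, t.graph.slots v s k = t.record [] k := by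
  obtain ⟨q, hq⟩ := exists_path_eq (t := t) (p := []) hne
  rw [Finset.sum_eq_single_of_mem q (Finset.mem_univ _)]
  · simp [slots_graph, hq]
  · intro p _ hp
    have hp' : path p ≠ [] := fun h => hp (path_injective (h.trans hq.symm))
    simp [slots_graph, hk (path p) hp']

end DTree

open Nat.Partrec.Code in
/-- A halting computation gives rise to a graph that satisfies the local condition. -/
theorem exists_graph_of_dom {e : Nat.Partrec.Code} (h : (e.eval 0).Dom) :
    ∃ G : LGraph 63, G.DegreeLE 4 ∧ G.NatLabelled ∧
      (∀ v, LocallyValid (G.slots v) (G.neighSlots v)) ∧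
      ∑ v, ∑ s, G.slots v s 7 = 1 ∧ ∑ v, ∑ s, G.slots v s 8 = encodeCode e + 1 := by
  obtain ⟨y, hy⟩ := Part.dom_iff_mem.1 h
  obtain ⟨t, hv, ht⟩ := evalDerivable e 0 y hy
  have hne : t ≠ .nil := by
    rintro rfl
    exact absurd (congrFun ht 0) (by simp [DTree.root])
  refine ⟨t.graph, t.degreeLE_graph, t.natLabelled_graph, t.locallyValid_graph hv ht, ?_, ?_⟩
  · rw [DTree.sum_slots_graph 7 _ hne]
    · simp [DTree.record, Fin.append, Fin.addCases]
    · intro p hp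
      simp [DTree.record, Fin.append, Fin.addCases, hp]
  · rw [DTree.sum_slots_graph 8 _ hne]
    · simp [DTree.record, Fin.append, Fin.addCases, ht]
    · intro p hp
      simp [DTree.record, Fin.append, Fin.addCases, hp]

/-! ### The reduction -/

/-- A combination network that computes the violation of the local condition, the root flag and
the number of the root. -/
theorem exists_combination_network : ∃ N : NN (63 + 63) 3, ∃ f : (Fin (63 + 63) → ℝ) → ℝ,
    (∀ x, 0 ≤ f x) ∧
    (∀ x, f x = 0 ↔ LocallyValid (fun s k => x (Fin.castAdd 63 (LGraph.slotIndex (s, k))))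
      (fun s k => x (Fin.natAdd 63 (LGraph.slotIndex (s, k))))) ∧
    ∀ x, N.eval x = ![f x,
      max 0 (∑ s : Fin 7, x (Fin.castAdd 63 (LGraph.slotIndex (s, (7 : Fin 9))))),
      max 0 (∑ s : Fin 7, x (Fin.castAdd 63 (LGraph.slotIndex (s, (8 : Fin 9)))))] := by
  obtain ⟨f, hf, f0, hiff⟩ := isPLPred_locallyValid (m := 63 + 63)
    (own := fun x s k => x (Fin.castAdd 63 (LGraph.slotIndex (s, k))))
    (nb := fun x s k => x (Fin.natAdd 63 (LGraph.slotIndex (s, k))))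
    (fun _ _ => .coord _) (fun _ _ => .coord _)
  have hsum : ∀ k : Fin 9, IsPL fun x : Fin (63 + 63) → ℝ =>
      ∑ s : Fin 7, x (Fin.castAdd 63 (LGraph.slotIndex (s, k))) :=
    fun k => IsPL.sum _ fun _ => .coord _
  obtain ⟨N, hN⟩ := IsPL.exists_NN (k := 3) (f := ![f,
    fun x => ∑ s : Fin 7, x (Fin.castAdd 63 (LGraph.slotIndex (s, (7 : Fin 9)))),
    fun x => ∑ s : Fin 7, x (Fin.castAdd 63 (LGraph.slotIndex (s, (8 : Fin 9))))]) (by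
      intro i
      fin_cases i
      · exact hf
      · exact hsum 7
      · exact hsum 8)
  refine ⟨N, f, f0, hiff, fun x => ?_⟩
  ext i
  rw [hN]
  fin_cases i
  · exact max_eq_right (f0 x)
  · rfl
  · rfl

/-- A network that computes `|x₀| + |x₁ - 1| + |x₂ - (n + 1)|` for non-negative `x₀`. -/
def readout (n : ℕ) : NN 3 1 :=
  .cons ⟨!![1, 0, 0; 0, 1, 0; 0, -1, 0; 0, 0, 1; 0, 0, -1],
      ![0, -1, 1, -((n + 1 : ℕ) : ℚ), (n + 1 : ℕ)]⟩
    (.last ⟨fun _ _ => 1, 0⟩)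

theorem readout_eval_eq_zero_iff (n : ℕ) {x : Fin 3 → ℝ} (hx : 0 ≤ x 0) :
    (readout n).eval x 0 = 0 ↔ x 0 = 0 ∧ x 1 = 1 ∧ x 2 = n + 1 := by
  have h : (readout n).eval x 0 = max 0 (max 0 (x 0) + max 0 (x 1 - 1) + max 0 (1 - x 1) +
      max 0 (x 2 - (n + 1)) + max 0 (n + 1 - x 2)) := by
    simp [readout, NN.eval, ReLULayer.eval, Fin.sum_univ_succ]
    ring_nf
  rw [h]
  constructor
  · intro h
    have h1 := le_max_right 0 (x 0)
    have h2 := le_max_right 0 (x 1 - 1)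
    have h3 := le_max_right 0 (1 - x 1)
    have h4 := le_max_right 0 (x 2 - (n + 1))
    have h5 := le_max_right 0 (n + 1 - x 2)
    have k1 := le_max_left 0 (x 0)
    have k2 := le_max_left 0 (x 1 - 1)
    have k3 := le_max_left 0 (1 - x 1)
    have k4 := le_max_left 0 (x 2 - (n + 1))
    have k5 := le_max_left 0 (n + 1 - x 2)
    have h6 := max_eq_left_iff.1 h
    refine ⟨?_, ?_, ?_⟩ <;> linarith
  · rintro ⟨h1, h2, h3⟩
    simp [h1, h2, h3]

theorem ratCode_natCast (n : ℕ) : ratCode n = (false, n, 1) := by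
  simp [ratCode]

/-- The offset by one pays off here: the sign bit of -(n+1) does not depend on `n`, whereas that of
-n would change at `n = 0`. -/
theorem ratCode_neg_natCast_succ (n : ℕ) : ratCode (-((n + 1 : ℕ) : ℚ)) = (true, n + 1, 1) := by
  have : (-((n + 1 : ℕ) : ℚ)) < 0 := by
    rw [neg_lt_zero]
    positivity
  simp only [ratCode, this, decide_true, Rat.neg_num, Rat.neg_den, Rat.num_natCast,
    Rat.den_natCast, Int.natAbs_neg, Int.natAbs_natCast]

theorem readout_code (n : ℕ) : (readout n).code =
    (3, [[([ratCode 1, ratCode 0, ratCode 0], ratCode 0),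
      ([ratCode 0, ratCode 1, ratCode 0], ratCode (-1)),
      ([ratCode 0, ratCode (-1), ratCode 0], ratCode 1),
      ([ratCode 0, ratCode 0, ratCode 1], (true, n + 1, 1)),
      ([ratCode 0, ratCode 0, ratCode (-1)], (false, n + 1, 1))],
      [([ratCode 1, ratCode 1, ratCode 1, ratCode 1, ratCode 1], ratCode 0)]]) := by
  rw [← ratCode_neg_natCast_succ, ← ratCode_natCast]
  rfl

theorem primrec_readout_code : Primrec fun n => (readout n).code := by
  simp only [readout_code]
  have hs : Primrec fun n : ℕ => ((n + 1, 1) : ℕ × ℕ) := Primrec.succ.pair (.const 1)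
  exact (Primrec.const 3).pair <| Primrec.list_cons.comp
    (Primrec.list_cons.comp (.const _) <| Primrec.list_cons.comp (.const _) <|
      Primrec.list_cons.comp (.const _) <|
      Primrec.list_cons.comp ((Primrec.const _).pair ((Primrec.const true).pair hs)) <|
      Primrec.list_cons.comp ((Primrec.const _).pair ((Primrec.const false).pair hs)) <|
      .const []) (.const _)

open Nat.Partrec.Code in
/-- Halting of programs reduces to output reachability, by means of a family of networks that
differ in a single bias and its negation. -/
theorem exists_halting_network : ∃ comb : NN (63 + 63) 3,
    (∀ (e : Nat.Partrec.Code) (G : LGraph 63),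
      (GraphMPNN.mk 3 (.last comb) (readout (encodeCode e))).eval G 0 = 0 → (e.eval 0).Dom) ∧
    ∀ e : Nat.Partrec.Code, (e.eval 0).Dom → ∃ G : LGraph 63, G.DegreeLE 4 ∧ G.NatLabelled ∧
      (GraphMPNN.mk 3 (.last comb) (readout (encodeCode e))).eval G 0 = 0 := by
  obtain ⟨comb, f, f0, hf, hcomb⟩ := exists_combination_network
  have key : ∀ (e : Nat.Partrec.Code) (G : LGraph 63),
      (GraphMPNN.mk 3 (.last comb) (readout (encodeCode e))).eval G 0 = 0 ↔
        (∀ v, LocallyValid (G.slots v) (G.neighSlots v)) ∧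
        ∑ v, max 0 (∑ s, G.slots v s 7) = 1 ∧
        ∑ v, max 0 (∑ s, G.slots v s 8) = encodeCode e + 1 := by
    intro e G
    have hx : ∀ v, comb.eval (Fin.append (G.label v) (∑ w ∈ G.neigh v, G.label w)) =
        ![f (Fin.append (G.label v) (∑ w ∈ G.neigh v, G.label w)),
          max 0 (∑ s, G.slots v s 7), max 0 (∑ s, G.slots v s 8)] := by
      intro v
      rw [hcomb]
      simp only [Fin.append_left]
      rfl
    have hl : ∀ v, f (Fin.append (G.label v) (∑ w ∈ G.neigh v, G.label w)) = 0 ↔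
        LocallyValid (G.slots v) (G.neighSlots v) := by
      intro v
      rw [hf]
      simp only [Fin.append_left, Fin.append_right, Finset.sum_apply]
      rfl
    simp only [GraphMPNN.eval, MPLayers.run, mpStep, hx]
    rw [readout_eval_eq_zero_iff]
    · simp only [Finset.sum_apply, Matrix.cons_val]
      -- Violations cannot cancel, so a zero total means that every node is valid.
      rw [Finset.sum_eq_zero_iff_of_nonneg fun v _ => f0 _]
      simp only [Finset.mem_univ, forall_const, hl]
    · simp only [Finset.sum_apply, Matrix.cons_val]
      exact Finset.sum_nonneg fun v _ => f0 _
  have relu : ∀ G : LGraph 63, (∀ v, LocallyValid (G.slots v) (G.neighSlots v)) → ∀ v,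
      max 0 (∑ s, G.slots v s 7) = ∑ s, G.slots v s 7 ∧
      max 0 (∑ s, G.slots v s 8) = ∑ s, G.slots v s 8 := by
    intro G h v
    exact ⟨max_eq_right (h v).sum_nonneg.1, max_eq_right (h v).sum_nonneg.2⟩
  refine ⟨comb, fun e G h => ?_, fun e h => ?_⟩
  · obtain ⟨hv, h7, h8⟩ := (key e G).1 h
    simp only [fun v => (relu G hv v).1] at h7
    simp only [fun v => (relu G hv v).2] at h8
    obtain ⟨e', he, hd⟩ := LGraph.exists_code_of_locallyValid hv h7 h8
    rwa [encodeCode_injective he] at hd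
  · obtain ⟨G, hdeg, hnat, hv, h7, h8⟩ := exists_graph_of_dom h
    refine ⟨G, hdeg, hnat, (key e G).2 ⟨hv, ?_, ?_⟩⟩
    · simpa only [fun v => (relu G hv v).1] using h7
    · simpa only [fun v => (relu G hv v).2] using h8

theorem theorem1 {Φ : Type u} [Primcodable Φ] (sat : Φ → ∀ n : ℕ, LGraph n → Prop)
    (hΦ : ContainsUnbounded sat) :
    ¬ FormallyVerifiable (ORPGraph.code (Φ := Φ)) (ORPGraph.Holds sat) := by
  rintro ⟨A, hA, hdec⟩
  obtain ⟨φ, hφ⟩ := hΦ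
  obtain ⟨comb, hsound, hcomplete⟩ := exists_halting_network
  let Q : Nat.Partrec.Code → ORPGraph Φ := fun e =>
    ⟨63, 1, ⟨3, .last comb, readout (Nat.Partrec.Code.encodeCode e)⟩, φ, ⟨0, 0⟩⟩
  have hQ : ∀ e, (Q e).Holds sat ↔ (e.eval 0).Dom := by
    intro e
    have hval : ∀ y : Fin 1 → ℝ, (⟨0, 0⟩ : EqSpec 1).Sat y ↔ y 0 = 0 := fun y => by
      simp [EqSpec.Sat]
    constructor
    -- Soundness holds for every graph, so nothing about the graphs satisfying `φ` is used in this
    -- direction.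
    · rintro ⟨G, -, hG⟩
      exact hsound e G ((hval _).1 hG)
    · intro h
      obtain ⟨G, hdeg, hnat, hG⟩ := hcomplete e h
      exact ⟨G, hφ 63 G hdeg hnat, (hval _).2 hG⟩
  have hcode : Computable fun e => (Q e).code := by
    have henc : Primrec Nat.Partrec.Code.encodeCode := Primrec.encode
    have hread : Primrec fun e : Nat.Partrec.Code => (readout e.encodeCode).code :=
      primrec_readout_code.comp henc
    have heq : ∀ e, (Q e).code =
        (([comb.code], (readout e.encodeCode).code), φ, (0, ratCode 0)) := fun _ => rfl
    simp only [heq]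
    exact (((Primrec.const [comb.code]).pair hread).pair
      (Primrec.const (φ, (0, ratCode 0)))).to_comp
  choose b hb hbQ using fun e => hdec (Q e)
  -- The verifier, run on the descriptions of the properties `Q e`, answers on all of them and so
  -- yields a total computable test for halting.
  have hcomp : Computable b := Partrec.of_eq_tot (hA.comp hcode) hb
  refine ComputablePred.halting_problem 0 (ComputablePred.computable_iff.2 ⟨b, hcomp, ?_⟩)
  ext e
  rw [← hQ e, ← hbQ e]
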